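/- Let $d,n\ge 1$, let $[a,b]=\prod_{i=1}^d[a_i,b_i]\subset\mathbb R^d$ with $a_i<b_i$ for all $i$, let $f:[a,b]\to\mathbb R$, and let $x_1,\dots,x_n\in[a,b]$; if $d\ge 2$, assume moreover that $x_{ki}<b_i$ for all $k,i$, where $x_{ki}$ is the $i$-th coordinate of $x_k$. Rescale the points to the unit cube by $$\tilde x_k=\Big(\frac{x_{k1}-a_1}{b_1-a_1},\dots,\frac{x_{kd}-a_d}{b_d-a_d}\Big),\qquad \tilde P=(\tilde x_1,\dots,\tilde x_n).$$ Let $$D_n^*(\tilde P)=\sup_{z\in[0,1]^d}\Big|\frac1n\,\#\{k:\tilde x_k\in\textstyle\prod_i[0,z_i)\}-\prod_{i=1}^d z_i\Big|$$ be the star discrepancy, and let $V_{HK}^{[a,b]}(f)\in[0,\infty]$ be the total variation of $f$ in the sense of Hardy and Krause: the sum, over all nonempty $u\subseteq\{1,\dots,d\}$, of the Vitali variations over $\prod_{i\in u}[a_i,b_i]$ of the functions obtained from $f$ by setting $x_i=b_i$ for $i\notin u$. Here the Vitali variation of a function $g$ over a box is the supremum, over all finite grids dividing the box, of the sum over the grid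 cells of the absolute value of the alternating sum of $g$ over the vertices of the cell. If $V_{HK}^{[a,b]}(f)<\infty$, then $f$ is Lebesgue integrable on $[a,b]$ and $$\Big|\int_{[a,b]}f(x)\,dx-\frac{\prod_{i=1}^d(b_i-a_i)}{n}\sum_{k=1}^n f(x_k)\Big|\le\prod_{i=1}^d(b_i-a_i)\cdot D_n^*(\tilde P)\cdot V_{HK}^{[a,b]}(f).$$ (If $V_{HK}^{[a,b]}(f)=\infty$, the right-hand side is $\infty$ and the inequality holds trivially.) -/

import Mathlib

open MeasureTheory
open scoped ENNReal

/-- The star discrepancy `D*_n(x₁, …, xₙ)`: the supremum over `z ∈ [0,1]^d` of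
`|(1/n) #{k : x k ∈ [0, z)} - ∏ i, z i|`, where `[0, z) = ∏ i, [0, z i)`. -/
noncomputable def starDiscrepancy {d n : ℕ} (x : Fin n → Fin d → ℝ) : ℝ :=
  ⨆ z : Set.Icc (0 : Fin d → ℝ) 1,
    |(1 / (n : ℝ)) * ∑ k, (Set.univ.pi fun i => Set.Ico (0 : ℝ) (z.1 i)).indicator 1 (x k)
      - ∏ i, z.1 i|

/-- The coordinatewise affine map that takes the box `[a, b]` onto the unit cube. -/
noncomputable def rescale {d : ℕ} (a b x : Fin d → ℝ) : Fin d → ℝ :=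
  fun i => (x i - a i) / (b i - a i)

section Variation

variable {ι : Type*} [Fintype ι] [DecidableEq ι]

/-- The alternating sum of `f` over the vertices of the box `[x, y]`; the vertex with coordinates
`x i` for `i ∈ v` and `y i` for `i ∉ v` carries the sign `(-1) ^ |v|`. -/
def boxDifference (f : (ι → ℝ) → ℝ) (x y : ι → ℝ) : ℝ :=
  ∑ v : Finset ι, (-1) ^ v.card * f (fun i => if i ∈ v then x i else y i)

/-- A grid on the box `[a, b]`: in each direction `i`, division points
`a i = pt i 0 ≤ pt i 1 ≤ ⋯ ≤ pt i (size i) = b i`. Repeated points are harmless, since a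
degenerate cell has box difference `0`; the values `pt i k` with `k > size i` play no role. -/
structure BoxGrid (a b : ι → ℝ) where
  size : ι → ℕ
  pt : ι → ℕ → ℝ
  mono : ∀ i, Monotone (pt i)
  pt_zero : ∀ i, pt i 0 = a i
  pt_size : ∀ i, pt i (size i) = b i

/-- The variation of `f` over `[a, b]` in the sense of Vitali: the supremum over all grids of the
sum over the cells of the absolute box differences. -/
noncomputable def vitaliVariation (f : (ι → ℝ) → ℝ) (a b : ι → ℝ) : ℝ≥0∞ :=
  ⨆ G : BoxGrid a b, ∑ k ∈ Fintype.piFinset fun i => Finset.range (G.size i),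
    ENNReal.ofReal |boxDifference f (fun i => G.pt i (k i)) (fun i => G.pt i (k i + 1))|

/-- The function of the variables `x i`, `i ∈ u`, obtained from `f` by setting the other variables
to the upper endpoints `b i`. -/
def restrictToFace (f : (ι → ℝ) → ℝ) (b : ι → ℝ) (u : Finset ι) (x : u → ℝ) : ℝ :=
  f (fun i => if h : i ∈ u then x ⟨i, h⟩ else b i)

/-- The total variation of `f` over `[a, b]` in the sense of Hardy and Krause (anchored at the
upper corner `b`): the sum over all nonempty sets `u` of coordinates of the Vitali variation of
the restriction of `f` to the face where `x i = b i` for `i ∉ u`. -/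
noncomputable def hardyKrauseVariation (f : (ι → ℝ) → ℝ) (a b : ι → ℝ) : ℝ≥0∞ :=
  ∑ u : Finset ι with u.Nonempty,
    vitaliVariation (restrictToFace f b u) (fun i : u => a i) (fun i : u => b i)

end Variation

/-!
The Koksma–Hlawka inequality on a box, for a function `f` that is only assumed to have finite
Hardy–Krause variation.

The inequality holds exactly on a grid. Fix a grid on `[a, b]` that has every coordinate of every
sample point among its division points, and replace `f` by the step function `f ∘ G.floor`, where
`G.floor y` is `y` with all coordinates rounded down to division points. Möbius inversion over the
sets of coordinates (`eq_sum_boxDifference_restrictToFace`) writes the value of `f` at a point as an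
alternating sum of box differences over the faces through the upper corner `b`, and box differences
telescope over the cells of a grid (`sum_boxDifference_eq`). Thus `f ∘ G.floor` is a linear
combination of indicators of corners `{y | ∀ i ∈ u, y i < c i}`, with the box differences of the
cells as coefficients (`BoxGrid.apply_floor_eq`). The quadrature error of each such indicator is at
most the volume times the star discrepancy (`abs_error_corner_le`) and is zero for `u = ∅`, and the
coefficients for `u ≠ ∅` have absolute sum at most the variation. Since rounding fixes the sample
points, this bounds the difference between `∫ f ∘ G.floor` and the quadrature sum of `f`
(`BoxGrid.abs_integral_comp_floor_sub_le`).

It remains to refine the grid. The variation `V x` of `f` over `[x, b]` is antitone in the lower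
corner `x`, and `|f x - f y| ≤ V x - V y` for `x ≤ y`
(`ofReal_abs_sub_add_hardyKrauseVariation_le`). Superlevel sets of `V` are lower sets, whose
boundaries are null, so `V` is continuous almost everywhere (`Antitone.ae_continuousAt_pi`), and at
such points `f (G.floor y)` tends to `f y`. As `f` is bounded, dominated convergence yields both
integrability and the inequality. If the variation is infinite, the right-hand side is infinite
because the star discrepancy is positive (`starDiscrepancy_pos`).
-/

/-! ### Box differences -/

section BoxDifference

variable {ι : Type*} [Fintype ι] [DecidableEq ι]

theorem boxDifference_congr {f g : (ι → ℝ) → ℝ} {x y : ι → ℝ} {T : ι → Finset ℝ}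
    (hx : ∀ i, x i ∈ T i) (hy : ∀ i, y i ∈ T i)
    (h : ∀ p ∈ Fintype.piFinset T, f p = g p) :
    boxDifference f x y = boxDifference g x y := by
  refine Finset.sum_congr rfl fun v _ => ?_
  rw [h]
  refine Fintype.mem_piFinset.2 fun i => ?_
  split_ifs
  exacts [hx i, hy i]

theorem boxDifference_sum_mul {κ : Type*} (s : Finset κ) (c : κ → ℝ) (g : κ → (ι → ℝ) → ℝ)
    (x y : ι → ℝ) :
    boxDifference (fun p => ∑ q ∈ s, c q * g q p) x y
      = ∑ q ∈ s, c q * boxDifference (g q) x y := by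
  simp only [boxDifference, Finset.mul_sum]
  rw [Finset.sum_comm]
  refine Finset.sum_congr rfl fun q _ => Finset.sum_congr rfl fun v _ => by ring

theorem boxDifference_prod (g : ι → ℝ → ℝ) (x y : ι → ℝ) :
    boxDifference (fun p => ∏ i, g i (p i)) x y = ∏ i, (g i (y i) - g i (x i)) := by
  simp_rw [sub_eq_neg_add, Fintype.prod_add, Finset.prod_neg, boxDifference]
  refine Finset.sum_congr rfl fun v _ => ?_
  rw [mul_assoc, ← Finset.prod_mul_prod_compl v]
  congr 2
  · exact Finset.prod_congr rfl fun i hi => by simp [hi]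
  · exact Finset.prod_congr rfl fun i hi => by simp [Finset.mem_compl.1 hi]

/-- Box differences telescope: on a block of cells of a grid they add up to the box difference over
the whole block. On the finitely many grid points `f` is a linear combination of products of
functions of one variable, and for such a product the sum over the cells factors into
one-dimensional telescoping sums. -/
theorem sum_boxDifference_eq (f : (ι → ℝ) → ℝ) (pt : ι → ℕ → ℝ) {m N : ι → ℕ}
    (hmN : ∀ i, m i ≤ N i) :
    ∑ k ∈ Fintype.piFinset fun i => Finset.Ico (m i) (N i),
        boxDifference f (fun i => pt i (k i)) (fun i => pt i (k i + 1))
      = boxDifference f (fun i => pt i (m i)) (fun i => pt i (N i)) := by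
  set T : ι → Finset ℝ := fun i => (Finset.range (N i + 1)).image (pt i) with hT
  have hmem : ∀ i k, k ≤ N i → pt i k ∈ T i := fun i k hk =>
    Finset.mem_image_of_mem _ (Finset.mem_range.2 (Nat.lt_succ_of_le hk))
  set δ : (ι → ℝ) → (ι → ℝ) → ℝ := fun q p => ∏ i, if p i = q i then 1 else 0 with hδ
  have hf : ∀ p ∈ Fintype.piFinset T,
      f p = (fun p => ∑ q ∈ Fintype.piFinset T, f q * δ q p) p := by
    intro p hp
    simp only [hδ, Finset.prod_ite_zero, Finset.mem_univ, true_implies, Finset.prod_const_one]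
    rw [Finset.sum_eq_single p]
    · simp
    · intro q _ hq
      rw [if_neg, mul_zero]
      exact fun h => hq (funext fun i => (h i).symm)
    · exact fun h => absurd hp h
  have hcell : ∀ k ∈ Fintype.piFinset fun i => Finset.Ico (m i) (N i),
      boxDifference f (fun i => pt i (k i)) (fun i => pt i (k i + 1))
        = ∑ q ∈ Fintype.piFinset T, f q *
            ∏ i, ((if pt i (k i + 1) = q i then (1 : ℝ) else 0)
              - if pt i (k i) = q i then (1 : ℝ) else 0) := by
    intro k hk
    have hk' : ∀ i, k i < N i := fun i => (Finset.mem_Ico.1 (Fintype.mem_piFinset.1 hk i)).2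
    rw [boxDifference_congr (fun i => hmem i _ (hk' i).le) (fun i => hmem i _ (hk' i)) hf,
      boxDifference_sum_mul]
    refine Finset.sum_congr rfl fun q _ => ?_
    rw [hδ, boxDifference_prod fun i t => if t = q i then (1 : ℝ) else 0]
  rw [Finset.sum_congr rfl hcell, Finset.sum_comm,
    boxDifference_congr (fun i => hmem i _ (hmN i)) (fun i => hmem i _ le_rfl) hf,
    boxDifference_sum_mul]
  refine Finset.sum_congr rfl fun q _ => ?_
  rw [← Finset.mul_sum, hδ, boxDifference_prod fun i t => if t = q i then (1 : ℝ) else 0,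
    ← Finset.prod_univ_sum (fun i => Finset.Ico (m i) (N i))
      fun i k => (if pt i (k + 1) = q i then (1 : ℝ) else 0) - if pt i k = q i then (1 : ℝ) else 0]
  congr 1
  exact Finset.prod_congr rfl fun i _ =>
    Finset.sum_Ico_sub (fun k => if pt i k = q i then (1 : ℝ) else 0) (hmN i)

omit [Fintype ι] in
theorem boxDifference_restrictToFace (f : (ι → ℝ) → ℝ) (b x : ι → ℝ) (u : Finset ι) :
    boxDifference (restrictToFace f b u) (fun i : u => x i) (fun i : u => b i)
      = ∑ v ∈ u.powerset, (-1) ^ v.card * f (fun i => if i ∈ v then x i else b i) := by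
  refine Finset.sum_bij' (fun v _ => v.map (.subtype (· ∈ u))) (fun t _ => t.subtype (· ∈ u))
    ?_ ?_ ?_ ?_ ?_
  · intro v _
    rw [Finset.mem_powerset]
    intro i hi
    obtain ⟨j, _, rfl⟩ := Finset.mem_map.1 hi
    exact j.2
  · simp
  · intro v _
    ext i
    simp
  · intro t ht
    exact Finset.subtype_map_of_mem fun i hi => Finset.mem_powerset.1 ht hi
  · intro v _
    rw [Finset.card_map, restrictToFace]
    congr 2
    funext i
    by_cases hi : i ∈ u <;> simp [hi]

/-- The value of `f` at `x` in terms of its box differences over the faces of `[x, b]` through the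
upper corner `b` (Möbius inversion over the sets of coordinates). -/
theorem eq_sum_boxDifference_restrictToFace (f : (ι → ℝ) → ℝ) (b x : ι → ℝ) :
    f x = ∑ u : Finset ι, (-1) ^ u.card *
      boxDifference (restrictToFace f b u) (fun i : u => x i) (fun i : u => b i) := by
  have key : ∀ v : Finset ι, ∑ u : Finset ι, (if v ⊆ u then (-1 : ℝ) ^ u.card else 0)
      = if v = Finset.univ then (-1) ^ v.card else 0 := by
    intro v
    have hterm : ∀ u : Finset ι, (if v ⊆ u then (-1 : ℝ) ^ u.card else 0)
        = (∏ _i ∈ u, (-1 : ℝ)) * ∏ i ∈ uᶜ, if i ∈ v then 0 else 1 := by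
      intro u
      by_cases h : v ⊆ u
      · rw [if_pos h, Finset.prod_const, Finset.prod_eq_one, mul_one]
        exact fun i hi => if_neg fun hv => Finset.mem_compl.1 hi (h hv)
      · obtain ⟨i, hiv, hiu⟩ := Finset.not_subset.1 h
        have h0 : ∏ i ∈ uᶜ, (if i ∈ v then (0 : ℝ) else 1) = 0 :=
          Finset.prod_eq_zero (Finset.mem_compl.2 hiu) (if_pos hiv)
        rw [if_neg h, h0, mul_zero]
    simp_rw [hterm]
    rw [← Fintype.prod_add]
    split_ifs with h
    · simp [h]
    · obtain ⟨i, hi⟩ : ∃ i, i ∉ v := by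
        by_contra! h'
        exact h (Finset.eq_univ_iff_forall.2 h')
      exact Finset.prod_eq_zero (Finset.mem_univ i) (by simp [hi])
  simp_rw [boxDifference_restrictToFace, Finset.mul_sum]
  have : ∀ u : Finset ι, ∑ v ∈ u.powerset,
      (-1 : ℝ) ^ u.card * ((-1) ^ v.card * f (fun i => if i ∈ v then x i else b i))
      = ∑ v : Finset ι, (if v ⊆ u then (-1 : ℝ) ^ u.card else 0) *
        ((-1) ^ v.card * f (fun i => if i ∈ v then x i else b i)) := by
    intro u
    simp only [ite_mul, zero_mul, ← Finset.sum_filter]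
    refine Finset.sum_congr ?_ fun _ _ => rfl
    ext; simp
  simp_rw [this]
  rw [Finset.sum_comm]
  simp_rw [← Finset.sum_mul, key]
  simp [← mul_assoc, ← mul_pow]

omit [Fintype ι] in
theorem boxDifference_restrictToFace_empty (f : (ι → ℝ) → ℝ) (b x : ι → ℝ) :
    boxDifference (restrictToFace f b ∅) (fun i : (∅ : Finset ι) => x i)
      (fun i : (∅ : Finset ι) => b i) = f b := by
  simp [boxDifference_restrictToFace f b x ∅]

end BoxDifference

/-! ### Rounding down to a grid -/

namespace BoxGrid

variable {ι : Type*} {a b : ι → ℝ} (G : BoxGrid a b)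

/-- The index of the last division point in direction `i` that is at most `t` (and `0` if there is
none). Repeated division points are counted, which makes `index_le_iff` hold for every grid. -/
noncomputable def index (i : ι) (t : ℝ) : ℕ :=
  Nat.findGreatest (fun k => G.pt i k ≤ t) (G.size i)

/-- The grid point obtained from `y` by rounding every coordinate down to a division point. -/
noncomputable def floor (y : ι → ℝ) : ι → ℝ := fun i => G.pt i (G.index i (y i))

/-- The grid induced on the face of `[a, b]` spanned by the coordinates in `u`. -/
def face (u : Finset ι) : BoxGrid (fun i : u => a i) (fun i : u => b i) where
  size i := G.size i
  pt i := G.pt i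
  mono i := G.mono i
  pt_zero i := G.pt_zero i
  pt_size i := G.pt_size i

theorem index_le_size (i : ι) (t : ℝ) : G.index i t ≤ G.size i := Nat.findGreatest_le _

theorem index_le_iff {i : ι} {t : ℝ} {k : ℕ} (hk : k < G.size i) :
    G.index i t ≤ k ↔ t < G.pt i (k + 1) := by
  constructor
  · intro h
    exact not_le.1 (Nat.findGreatest_is_greatest (P := fun k => G.pt i k ≤ t)
      (Nat.lt_succ_of_le h) hk)
  · intro h
    by_contra! hlt
    have h1 : G.pt i (G.index i t) ≤ t :=
      Nat.findGreatest_of_ne_zero (P := fun k => G.pt i k ≤ t) rfl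
        (Nat.ne_of_gt (Nat.zero_lt_of_lt hlt))
    exact absurd (h.trans_le (G.mono i hlt)) (not_lt.2 h1)

theorem lower_le_upper (G : BoxGrid a b) : a ≤ b := by
  intro i
  rw [← G.pt_zero i, ← G.pt_size i]
  exact G.mono i (Nat.zero_le _)

theorem pt_mem_Icc {i : ι} {k : ℕ} (hk : k ≤ G.size i) :
    G.pt i k ∈ Set.Icc (a i) (b i) :=
  ⟨(G.pt_zero i).symm.trans_le (G.mono i (Nat.zero_le k)), (G.mono i hk).trans_eq (G.pt_size i)⟩

theorem floor_le {y : ι → ℝ} (hy : a ≤ y) : G.floor y ≤ y := fun i =>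
  Nat.findGreatest_spec (P := fun k => G.pt i k ≤ y i) (Nat.zero_le _)
    ((G.pt_zero i).trans_le (hy i))

theorem le_floor (y : ι → ℝ) : a ≤ G.floor y := fun i =>
  (G.pt_zero i).symm.trans_le (G.mono i (Nat.zero_le _))

theorem pt_le_floor {y : ι → ℝ} {i : ι} {k : ℕ} (hk : k ≤ G.size i) (h : G.pt i k ≤ y i) :
    G.pt i k ≤ G.floor y i :=
  G.mono i (Nat.le_findGreatest hk h)

theorem floor_eq_self {y : ι → ℝ} (hy : ∀ i, ∃ k ≤ G.size i, G.pt i k = y i) :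
    G.floor y = y := by
  have ha : a ≤ y := fun i => by
    obtain ⟨k, _, hk⟩ := hy i
    exact (G.pt_zero i).symm.trans_le ((G.mono i (Nat.zero_le k)).trans_eq hk)
  refine le_antisymm (G.floor_le ha) fun i => ?_
  obtain ⟨k, hk, h⟩ := hy i
  exact h.symm.trans_le (G.pt_le_floor hk h.le)

variable [DecidableEq ι]

theorem sum_ofReal_abs_boxDifference_le [Fintype ι] (f : (ι → ℝ) → ℝ) :
    ∑ k ∈ Fintype.piFinset fun i => Finset.range (G.size i), ENNReal.ofReal
        |boxDifference f (fun i => G.pt i (k i)) (fun i => G.pt i (k i + 1))|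
      ≤ vitaliVariation f a b :=
  le_iSup (fun G : BoxGrid a b => ∑ k ∈ Fintype.piFinset fun i => Finset.range (G.size i),
    ENNReal.ofReal |boxDifference f (fun i => G.pt i (k i)) (fun i => G.pt i (k i + 1))|) G

/-- Summation by parts on a grid: at the grid point below `y`, `f` is a combination of the
indicators of the corners `{y | ∀ i ∈ u, y i < c i}`, with box differences of `f` over the cells
of the faces as coefficients. -/
theorem apply_floor_eq [Fintype ι] (f : (ι → ℝ) → ℝ) (y : ι → ℝ) :
    f (G.floor y) = ∑ u : Finset ι, (-1) ^ u.card *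
      ∑ k ∈ Fintype.piFinset fun i : u => Finset.range (G.size i),
        boxDifference (restrictToFace f b u) (fun i : u => G.pt i (k i))
            (fun i : u => G.pt i (k i + 1)) *
          {y : ι → ℝ | ∀ i : u, y i < G.pt i (k i + 1)}.indicator 1 y := by
  rw [eq_sum_boxDifference_restrictToFace f b (G.floor y)]
  refine Finset.sum_congr rfl fun u _ => ?_
  congr 1
  have h := sum_boxDifference_eq (restrictToFace f b u) (fun i : u => G.pt i)
    (m := fun i : u => G.index i (y i)) (N := fun i : u => G.size i)
    fun i => G.index_le_size i (y i)
  simp only [G.pt_size] at h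
  refine h.symm.trans ?_
  simp only [Set.indicator_apply, Set.mem_ofPred_eq, Pi.one_apply, mul_ite, mul_one, mul_zero]
  rw [← Finset.sum_filter]
  refine Finset.sum_congr ?_ fun _ _ => rfl
  ext k
  simp only [Fintype.mem_piFinset, Finset.mem_Ico, Finset.mem_filter, Finset.mem_range]
  constructor
  · exact fun h => ⟨fun i => (h i).2, fun i => (G.index_le_iff (h i).2).1 (h i).1⟩
  · exact fun h i => ⟨(G.index_le_iff (h.1 i)).2 (h.2 i), h.1 i⟩

end BoxGrid

/-- The points of a finite subset of `[α, β]` are division points of some subdivision of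
`[α, β]`. -/
theorem exists_monotone_subdivision {α β : ℝ} (hαβ : α ≤ β) (S : Finset ℝ)
    (hS : ∀ s ∈ S, s ∈ Set.Icc α β) :
    ∃ (N : ℕ) (pt : ℕ → ℝ), Monotone pt ∧ pt 0 = α ∧ pt N = β ∧ ∀ s ∈ S, ∃ k ≤ N, pt k = s := by
  classical
  induction S using Finset.induction_on with
  | empty =>
    refine ⟨1, fun k => if k = 0 then α else β, ?_, by simp, by simp, by simp⟩
    refine monotone_nat_of_le_succ fun k => ?_
    by_cases hk : k = 0 <;> simp [hk, hαβ]
  | insert c S _ ih =>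
    obtain ⟨N, pt, hmono, h0, hN, hSpt⟩ := ih fun s hs => hS s (Finset.mem_insert_of_mem hs)
    obtain ⟨hαc, hcβ⟩ := hS c (Finset.mem_insert_self _ _)
    -- `c` is inserted after the last `pt k ≤ c`: below it the sequence is unchanged, above it is
    -- shifted by one.
    have hm : ∀ k, pt (k - 1) ≤ pt k := fun k => hmono (Nat.sub_le _ _)
    refine ⟨N + 1, fun k => max (pt (k - 1)) (min (pt k) c), ?_, ?_, ?_, ?_⟩
    · exact fun k l hkl => max_le_max (hmono (by omega)) (min_le_min_right _ (hmono hkl))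
    · simp [h0]
    · simp only [Nat.add_sub_cancel, hN]
      exact max_eq_left ((min_le_right _ _).trans hcβ)
    · intro s hs
      rcases Finset.mem_insert.1 hs with rfl | hs
      · have hex : ∃ k, s ≤ pt k := ⟨N, hN ▸ hcβ⟩
        refine ⟨Nat.find hex, (Nat.find_min' hex (hN ▸ hcβ)).trans (Nat.le_succ _), ?_⟩
        beta_reduce
        rw [min_eq_right (Nat.find_spec hex), max_eq_right]
        by_cases hz : Nat.find hex = 0
        · rw [hz, h0]
          exact hαc
        · exact (not_le.1 (Nat.find_min hex (by omega : Nat.find hex - 1 < _))).le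
      · obtain ⟨k, hk, rfl⟩ := hSpt s hs
        by_cases hkc : pt k ≤ c
        · exact ⟨k, by omega, by simp only [min_eq_left hkc, max_eq_right (hm k)]⟩
        · refine ⟨k + 1, by omega, ?_⟩
          simp only [Nat.add_sub_cancel]
          exact max_eq_left ((min_le_right _ _).trans (not_le.1 hkc).le)

theorem BoxGrid.exists_pt_eq {ι : Type*} {a b : ι → ℝ} (hab : a ≤ b) (S : ι → Finset ℝ)
    (hS : ∀ i, ∀ s ∈ S i, s ∈ Set.Icc (a i) (b i)) :
    ∃ G : BoxGrid a b, ∀ i, ∀ s ∈ S i, ∃ k ≤ G.size i, G.pt i k = s := by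
  choose N pt hmono h0 hN hpt using fun i => exists_monotone_subdivision (hab i) (S i) (hS i)
  exact ⟨⟨N, pt, hmono, h0, hN⟩, hpt⟩

/-! ### The variation as a function of the lower corner -/

section Monotonicity

variable {ι : Type*} [Fintype ι] [DecidableEq ι]

/-- The grid on `[x, b]` obtained from a grid on `[y, b]`, where `x ≤ y`, by adding `x i` as first
division point in every direction. -/
def BoxGrid.extend {x y b : ι → ℝ} (G : BoxGrid y b) (hxy : x ≤ y) : BoxGrid x b where
  size i := G.size i + 1
  pt i k := Nat.casesOn k (x i) (G.pt i)
  mono i := by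
    refine monotone_nat_of_le_succ fun k => ?_
    cases k with
    | zero => exact (hxy i).trans_eq (G.pt_zero i).symm
    | succ k => exact G.mono i (Nat.le_succ k)
  pt_zero _ := rfl
  pt_size i := G.pt_size i

/-- The Vitali variation is superadditive when the lower corner is moved: the cells of a grid on
`[x, b]` outside `[y, b]` account for the change of the box difference. -/
theorem ofReal_abs_boxDifference_sub_add_vitaliVariation_le (f : (ι → ℝ) → ℝ) {x y b : ι → ℝ}
    (hxy : x ≤ y) (hyb : y ≤ b) :
    ENNReal.ofReal |boxDifference f x b - boxDifference f y b| + vitaliVariation f y b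
      ≤ vitaliVariation f x b := by
  obtain ⟨G₀, -⟩ := BoxGrid.exists_pt_eq hyb (fun _ => ∅) (by simp)
  have : Nonempty (BoxGrid y b) := ⟨G₀⟩
  rw [vitaliVariation, ENNReal.add_iSup]
  refine iSup_le fun G => le_trans ?_ ((G.extend hxy).sum_ofReal_abs_boxDifference_le f)
  set H := G.extend hxy with hH
  set D : (ι → ℕ) → ℝ := fun k =>
    boxDifference f (fun i => H.pt i (k i)) (fun i => H.pt i (k i + 1)) with hD
  set A := Fintype.piFinset fun i => Finset.Ico 1 (G.size i + 1) with hA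
  set T := Fintype.piFinset fun i => Finset.range (H.size i) with hT
  have hAT : A ⊆ T := Fintype.piFinset_subset _ _ fun i k hk =>
    Finset.mem_range.2 (Finset.mem_Ico.1 hk).2
  have hsumT : ∑ k ∈ T, D k = boxDifference f x b := by
    have h := sum_boxDifference_eq f H.pt (m := 0) (N := H.size) fun i => Nat.zero_le _
    simpa only [Pi.zero_apply, Nat.Ico_zero_eq_range, H.pt_zero, H.pt_size] using h
  have hsumA : ∑ k ∈ A, D k = boxDifference f y b := by
    have h := sum_boxDifference_eq f H.pt (m := 1) (N := H.size) fun i => Nat.succ_le_succ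
      (Nat.zero_le _)
    have h1 : (fun i => H.pt i 1) = y := funext fun i => G.pt_zero i
    simp only [Pi.one_apply, H.pt_size, h1] at h
    exact h
  have hdiff : boxDifference f x b - boxDifference f y b = ∑ k ∈ T \ A, D k := by
    rw [← hsumT, ← hsumA, ← Finset.sum_sdiff hAT, add_sub_cancel_right]
  have hshift : ∑ k ∈ Fintype.piFinset fun i => Finset.range (G.size i), ENNReal.ofReal
        |boxDifference f (fun i => G.pt i (k i)) (fun i => G.pt i (k i + 1))|
      = ∑ k ∈ A, ENNReal.ofReal |D k| := by
    refine Finset.sum_bij' (fun k _ i => k i + 1) (fun k _ i => k i - 1) ?_ ?_ ?_ ?_ ?_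
    · intro k hk
      simp only [hA, Fintype.mem_piFinset, Finset.mem_Ico, Finset.mem_range] at hk ⊢
      intro i
      have := hk i
      omega
    · intro k hk
      simp only [hA, Fintype.mem_piFinset, Finset.mem_Ico, Finset.mem_range] at hk ⊢
      intro i
      have := hk i
      omega
    · intro k _
      rfl
    · intro k hk
      simp only [hA, Fintype.mem_piFinset, Finset.mem_Ico] at hk
      funext i
      have := hk i
      dsimp only
      omega
    · intro k _
      rfl
  rw [hshift, ← Finset.sum_sdiff hAT]
  gcongr
  rw [hdiff, ← ENNReal.ofReal_sum_of_nonneg fun _ _ => abs_nonneg _]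
  exact ENNReal.ofReal_le_ofReal (Finset.abs_sum_le_sum_abs _ _)

/-- No condition relates the lower corners to `b`: for `y ≰ b` there is no grid on `[y, b]`, so
that the variation is `0`. -/
theorem vitaliVariation_antitone (f : (ι → ℝ) → ℝ) (b : ι → ℝ) :
    Antitone fun x => vitaliVariation f x b := by
  intro x y hxy
  by_cases hyb : y ≤ b
  · exact le_trans le_add_self
      (ofReal_abs_boxDifference_sub_add_vitaliVariation_le f hxy hyb)
  · have : IsEmpty (BoxGrid y b) := ⟨fun G => hyb G.lower_le_upper⟩
    simp [vitaliVariation]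

theorem hardyKrauseVariation_antitone (f : (ι → ℝ) → ℝ) (b : ι → ℝ) :
    Antitone fun x => hardyKrauseVariation f x b := fun _ _ hxy =>
  Finset.sum_le_sum fun u _ => vitaliVariation_antitone (restrictToFace f b u) _
    fun i : u => hxy i

/-- The Hardy–Krause variation over `[x, b]` controls the increments of `f`. Together with
antitonicity this replaces the Jordan decomposition of `f`. -/
theorem ofReal_abs_sub_add_hardyKrauseVariation_le (f : (ι → ℝ) → ℝ) {x y b : ι → ℝ}
    (hxy : x ≤ y) (hyb : y ≤ b) :
    ENNReal.ofReal |f x - f y| + hardyKrauseVariation f y b ≤ hardyKrauseVariation f x b := by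
  set Δ : Finset ι → (ι → ℝ) → ℝ := fun u z =>
    boxDifference (restrictToFace f b u) (fun i : u => z i) (fun i : u => b i) with hΔ
  have hsub : f x - f y = ∑ u : Finset ι with u.Nonempty, (-1) ^ u.card * (Δ u x - Δ u y) := by
    rw [Finset.sum_filter_of_ne]
    · rw [eq_sum_boxDifference_restrictToFace f b x, eq_sum_boxDifference_restrictToFace f b y,
        ← Finset.sum_sub_distrib]
      simp only [hΔ, mul_sub]
    · intro u _ hu
      rw [Finset.nonempty_iff_ne_empty]
      rintro rfl
      simp [hΔ, boxDifference_restrictToFace_empty] at hu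
  have habs : |f x - f y| ≤ ∑ u : Finset ι with u.Nonempty, |Δ u x - Δ u y| := by
    rw [hsub]
    refine (Finset.abs_sum_le_sum_abs _ _).trans_eq (Finset.sum_congr rfl fun u _ => ?_)
    simp [abs_mul]
  calc ENNReal.ofReal |f x - f y| + hardyKrauseVariation f y b
      ≤ ∑ u : Finset ι with u.Nonempty, ENNReal.ofReal |Δ u x - Δ u y|
          + hardyKrauseVariation f y b := by
        gcongr
        rw [← ENNReal.ofReal_sum_of_nonneg fun _ _ => abs_nonneg _]
        exact ENNReal.ofReal_le_ofReal habs
    _ ≤ hardyKrauseVariation f x b := by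
        rw [hardyKrauseVariation, ← Finset.sum_add_distrib]
        exact Finset.sum_le_sum fun u _ => ofReal_abs_boxDifference_sub_add_vitaliVariation_le
          (restrictToFace f b u) (fun i : u => hxy i) fun i : u => hyb i

end Monotonicity

/-! ### Continuity almost everywhere -/

/-- A coordinatewise antitone function is continuous almost everywhere: outside the boundaries of
countably many superlevel sets, which are lower sets. -/
theorem Antitone.ae_continuousAt_pi {ι : Type*} [Fintype ι] {V : (ι → ℝ) → ℝ≥0∞}
    (hV : Antitone V) : ∀ᵐ x, ContinuousAt V x := by
  obtain ⟨Q, hQ, hQd⟩ := TopologicalSpace.exists_countable_dense ℝ≥0∞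
  have hlower : ∀ q, IsLowerSet {x | q < V x} := fun q x y hyx hx => lt_of_lt_of_le hx (hV hyx)
  have h : ∀ᵐ x : ι → ℝ, ∀ q ∈ Q, x ∉ frontier {x | q < V x} :=
    (ae_ball_iff hQ).2 fun q _ => measure_eq_zero_iff_ae_notMem.1 (hlower q).null_frontier
  filter_upwards [h] with x hx
  refine tendsto_order.2 ⟨fun r hr => ?_, fun r hr => ?_⟩
  · obtain ⟨q, hqQ, hrq, hqV⟩ := hQd.exists_between hr
    have hmem : {x | q < V x} ∈ nhds x := by
      by_contra hn
      exact hx q hqQ ⟨subset_closure hqV, fun hi => hn (mem_interior_iff_mem_nhds.1 hi)⟩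
    filter_upwards [hmem] with y hy using hrq.trans hy
  · obtain ⟨q, hqQ, hVq, hqr⟩ := hQd.exists_between hr
    have hmem : {x | q < V x}ᶜ ∈ nhds x := by
      have h1 := hx q hqQ
      rw [← frontier_compl] at h1
      by_contra hn
      exact h1 ⟨subset_closure (not_lt.2 hVq.le), fun hi => hn (mem_interior_iff_mem_nhds.1 hi)⟩
    filter_upwards [hmem] with y hy
    have hy' : ¬ q < V y := hy
    exact (not_lt.1 hy').trans_lt hqr

/-! ### The star discrepancy -/

theorem bddAbove_starDiscrepancy {d n : ℕ} (x : Fin n → Fin d → ℝ) :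
    BddAbove (Set.range fun z : Set.Icc (0 : Fin d → ℝ) 1 =>
      |(1 / (n : ℝ)) * ∑ k, (Set.univ.pi fun i => Set.Ico (0 : ℝ) (z.1 i)).indicator 1 (x k)
        - ∏ i, z.1 i|) := by
  refine ⟨1, ?_⟩
  rintro _ ⟨⟨z, hz0, hz1⟩, rfl⟩
  set Q : Set (Fin d → ℝ) := Set.univ.pi fun i => Set.Ico (0 : ℝ) (z i)
  have hsum0 : 0 ≤ ∑ k, Q.indicator (1 : (Fin d → ℝ) → ℝ) (x k) :=
    Finset.sum_nonneg fun k _ => Set.indicator_nonneg (fun _ _ => zero_le_one) _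
  have hsum1 : ∑ k, Q.indicator (1 : (Fin d → ℝ) → ℝ) (x k)
      ≤ n := by
    refine (Finset.sum_le_card_nsmul _ _ 1 fun k _ => ?_).trans_eq (by simp)
    exact Set.indicator_le_self' (fun _ _ => zero_le_one) _
  have hprod0 : 0 ≤ ∏ i, z i := Finset.prod_nonneg fun i _ => hz0 i
  have hprod1 : ∏ i, z i ≤ 1 := Finset.prod_le_one (fun i _ => hz0 i) fun i _ => hz1 i
  have hmean : (1 / (n : ℝ)) *
      ∑ k, Q.indicator (1 : (Fin d → ℝ) → ℝ) (x k) ≤ 1 := by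
    rw [one_div, inv_mul_eq_div]
    exact div_le_one_of_le₀ hsum1 (Nat.cast_nonneg n)
  have hmean0 : 0 ≤ (1 / (n : ℝ)) *
      ∑ k, Q.indicator (1 : (Fin d → ℝ) → ℝ) (x k) := by
    positivity
  exact abs_le.2 ⟨by linarith, by linarith⟩

theorem abs_le_starDiscrepancy {d n : ℕ} (x : Fin n → Fin d → ℝ) {z : Fin d → ℝ}
    (hz : z ∈ Set.Icc (0 : Fin d → ℝ) 1) :
    |(1 / (n : ℝ)) * ∑ k, (Set.univ.pi fun i => Set.Ico (0 : ℝ) (z i)).indicator 1 (x k)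
        - ∏ i, z i| ≤ starDiscrepancy x :=
  le_ciSup (bddAbove_starDiscrepancy x) ⟨z, hz⟩

/-- The star discrepancy is at least `1 / (2n)`: the box `[0, 1/(2n)) × [0, 1)^(d-1)` has volume
`1 / (2n)`, while the proportion of points in it is a multiple of `1 / n`. -/
theorem starDiscrepancy_pos {d n : ℕ} (hd : 0 < d) (hn : 0 < n) (x : Fin n → Fin d → ℝ) :
    0 < starDiscrepancy x := by
  have hn' : (0 : ℝ) < n := Nat.cast_pos.2 hn
  have hn1 : (1 : ℝ) ≤ n := Nat.one_le_cast.2 hn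
  set t : ℝ := 1 / (2 * n) with ht
  have ht0 : 0 < t := by positivity
  have ht1 : t ≤ 1 := by
    rw [ht, div_le_one (by positivity)]
    linarith
  set z : Fin d → ℝ := Function.update 1 ⟨0, hd⟩ t with hz
  have hz01 : z ∈ Set.Icc (0 : Fin d → ℝ) 1 := by
    constructor <;> intro i <;> by_cases hi : i = ⟨0, hd⟩ <;> simp [hz, hi, ht0.le, ht1]
  have hprod : ∏ i, z i = t := by
    simp [hz, Finset.prod_update_of_mem]
  refine lt_of_lt_of_le ?_ (abs_le_starDiscrepancy x hz01)
  rw [hprod]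
  classical
  obtain ⟨m, hm⟩ : ∃ m : ℕ, ∑ k, (Set.univ.pi fun i => Set.Ico (0 : ℝ) (z i)).indicator
      (1 : (Fin d → ℝ) → ℝ) (x k) = m := by
    refine ⟨(Finset.univ.filter fun k => x k ∈ Set.univ.pi fun i => Set.Ico (0 : ℝ) (z i)).card, ?_⟩
    simp only [Set.indicator_apply, Pi.one_apply, Finset.sum_boole]
  rw [hm, abs_pos, sub_ne_zero, ht]
  intro h
  have h2 : (2 * m : ℝ) = 1 := by
    field_simp at h
    linarith
  have h3 : 2 * m = 1 := by exact_mod_cast h2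
  omega

theorem measurableSet_corner {ι : Type*} {u : Finset ι} (c : u → ℝ) :
    MeasurableSet {y : ι → ℝ | ∀ i : u, y i < c i} := by
  simp only [Set.ofPred_forall]
  exact MeasurableSet.iInter fun i => measurableSet_lt (measurable_pi_apply _) measurable_const

/-- The quadrature error for the indicator of a corner `{y | ∀ i ∈ u, y i < c i}` of the box. Its
image in the unit cube is the box `[0, z)` where `z i = 1` for `i ∉ u`, up to the points with some
coordinate `1` outside `u`. There is no such point in the sample: if `d ≥ 2` by `hxb`, and if
`d = 1` since `u` contains the only coordinate. -/
theorem abs_error_corner_le {d n : ℕ} (a b : Fin d → ℝ) (hab : ∀ i, a i < b i)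
    (x : Fin n → Fin d → ℝ) (hx : ∀ k, x k ∈ Set.Icc a b)
    (hxb : 2 ≤ d → ∀ k i, x k i < b i) {u : Finset (Fin d)} (hu : u.Nonempty) (c : u → ℝ)
    (hc : ∀ i : u, c i ∈ Set.Icc (a i) (b i)) :
    |(∫ y in Set.Icc a b, {y : Fin d → ℝ | ∀ i : u, y i < c i}.indicator (1 : (Fin d → ℝ) → ℝ) y)
        - (∏ i, (b i - a i)) / n *
          ∑ k, {y : Fin d → ℝ | ∀ i : u, y i < c i}.indicator (1 : (Fin d → ℝ) → ℝ) (x k)|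
      ≤ (∏ i, (b i - a i)) * starDiscrepancy fun k => rescale a b (x k) := by
  set C := {y : Fin d → ℝ | ∀ i : u, y i < c i} with hC
  set z : Fin d → ℝ := fun i => if h : i ∈ u then (c ⟨i, h⟩ - a i) / (b i - a i) else 1 with hz
  have hpos : ∀ i, 0 < b i - a i := fun i => sub_pos.2 (hab i)
  have hvol : 0 ≤ ∏ i, (b i - a i) := Finset.prod_nonneg fun i _ => (hpos i).le
  have hz01 : z ∈ Set.Icc (0 : Fin d → ℝ) 1 := by
    constructor <;> intro i <;> by_cases hi : i ∈ u <;> simp only [hz, hi, dif_pos, dif_neg,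
      not_false_eq_true, Pi.zero_apply, Pi.one_apply, zero_le_one, le_refl]
    · exact div_nonneg (sub_nonneg.2 (hc ⟨i, hi⟩).1) (hpos i).le
    · exact div_le_one_of_le₀ (sub_le_sub_right (hc ⟨i, hi⟩).2 _) (hpos i).le
  have hmeas : MeasurableSet C := measurableSet_corner c
  have hint : (∫ y in Set.Icc a b, C.indicator (1 : (Fin d → ℝ) → ℝ) y)
      = (∏ i, (b i - a i)) * ∏ i, z i := by
    have hset : C ∩ Set.Icc a b = Set.univ.pi fun i =>
        if h : i ∈ u then Set.Ico (a i) (c ⟨i, h⟩) else Set.Icc (a i) (b i) := by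
      ext y
      simp only [hC, Set.mem_inter_iff, Set.mem_ofPred_eq, Set.mem_Icc, Pi.le_def, Set.mem_univ_pi]
      constructor
      · rintro ⟨h1, h2, h3⟩ i
        by_cases hi : i ∈ u
        · simpa [hi] using ⟨h2 i, h1 ⟨i, hi⟩⟩
        · simpa [hi] using ⟨h2 i, h3 i⟩
      · intro h
        refine ⟨fun i => ?_, fun i => ?_, fun i => ?_⟩
        · have := h i
          rw [dif_pos i.2] at this
          exact this.2
        · have := h i
          by_cases hi : i ∈ u
          · rw [dif_pos hi] at this
            exact this.1
          · rw [dif_neg hi] at this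
            exact this.1
        · have := h i
          by_cases hi : i ∈ u
          · rw [dif_pos hi] at this
            exact this.2.le.trans (hc ⟨i, hi⟩).2
          · rw [dif_neg hi] at this
            exact this.2
    rw [integral_indicator_one hmeas, measureReal_restrict_apply hmeas, hset, Measure.real,
      volume_pi_pi, ENNReal.toReal_prod, ← Finset.prod_mul_distrib]
    refine Finset.prod_congr rfl fun i _ => ?_
    by_cases hi : i ∈ u
    · simp only [hz, dif_pos hi, mul_div_cancel₀ _ (hpos i).ne', Real.volume_Ico]
      exact ENNReal.toReal_ofReal (sub_nonneg.2 (hc ⟨i, hi⟩).1)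
    · simp only [hz, dif_neg hi, mul_one, Real.volume_Icc]
      exact ENNReal.toReal_ofReal (hpos i).le
  have hind : ∀ k, C.indicator (1 : (Fin d → ℝ) → ℝ) (x k)
      = (Set.univ.pi fun i => Set.Ico (0 : ℝ) (z i)).indicator 1 (rescale a b (x k)) := by
    intro k
    have hiff : x k ∈ C ↔ rescale a b (x k) ∈ Set.univ.pi fun i => Set.Ico (0 : ℝ) (z i) := by
      simp only [hC, Set.mem_ofPred_eq, Set.mem_univ_pi, Set.mem_Ico, rescale]
      constructor
      · intro h i
        refine ⟨div_nonneg (sub_nonneg.2 ((hx k).1 i)) (hpos i).le, ?_⟩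
        by_cases hi : i ∈ u
        · simp only [hz, dif_pos hi]
          exact div_lt_div_of_pos_right (sub_lt_sub_right (h ⟨i, hi⟩) _) (hpos i)
        · simp only [hz, dif_neg hi]
          have hd : 2 ≤ d := by
            obtain ⟨j, hj⟩ := hu
            have : j ≠ i := fun h => hi (h ▸ hj)
            have := Fin.val_ne_of_ne this
            omega
          rw [div_lt_one (hpos i)]
          exact sub_lt_sub_right (hxb hd k i) _
      · intro h i
        have := (h i).2
        simp only [hz, dif_pos i.2] at this
        exact (sub_lt_sub_iff_right _).1 ((div_lt_div_iff_of_pos_right (hpos i)).1 this)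
    by_cases h : x k ∈ C
    · rw [Set.indicator_of_mem h, Set.indicator_of_mem (hiff.1 h), Pi.one_apply, Pi.one_apply]
    · rw [Set.indicator_of_notMem h, Set.indicator_of_notMem fun h' => h (hiff.2 h')]
  simp_rw [hind, hint]
  rw [show ∀ V P S : ℝ, V * P - V / n * S = -(V * (1 / n * S - P)) from fun V P S => by ring,
    abs_neg, abs_mul, abs_of_nonneg hvol]
  exact mul_le_mul_of_nonneg_left (abs_le_starDiscrepancy _ hz01) hvol

/-! ### The inequality on a grid -/

section Grid

variable {d n : ℕ} {a b : Fin d → ℝ} (G : BoxGrid a b)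

theorem integrableOn_indicator_corner (a b : Fin d → ℝ) {u : Finset (Fin d)} (c : u → ℝ) :
    IntegrableOn ({y : Fin d → ℝ | ∀ i : u, y i < c i}.indicator (1 : (Fin d → ℝ) → ℝ))
      (Set.Icc a b) :=
  IntegrableOn.indicator (f := fun _ => (1 : ℝ))
    (integrableOn_const (isCompact_Icc.measure_lt_top.ne)) (measurableSet_corner c)

theorem BoxGrid.integrableOn_comp_floor (f : (Fin d → ℝ) → ℝ) :
    IntegrableOn (fun y => f (G.floor y)) (Set.Icc a b) := by
  simp_rw [G.apply_floor_eq f]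
  exact integrable_finsetSum _ fun u _ => Integrable.const_mul (integrable_finsetSum _ fun k _ =>
    Integrable.const_mul (integrableOn_indicator_corner a b _) _) _

/-- If all sample points are grid points, the error for the step function `f ∘ G.floor` obeys the
Koksma–Hlawka bound: by `BoxGrid.apply_floor_eq` it is a combination of the errors for corners,
and the corner of the empty face is the whole space, whose error is `0`. -/
theorem BoxGrid.abs_integral_comp_floor_sub_le (hn : 0 < n) (hab : ∀ i, a i < b i)
    (f : (Fin d → ℝ) → ℝ) (x : Fin n → Fin d → ℝ) (hx : ∀ k, x k ∈ Set.Icc a b)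
    (hxb : 2 ≤ d → ∀ k i, x k i < b i) (hV : hardyKrauseVariation f a b ≠ ∞)
    (hG : ∀ k, G.floor (x k) = x k) :
    |(∫ y in Set.Icc a b, f (G.floor y)) - (∏ i, (b i - a i)) / n * ∑ k, f (x k)|
      ≤ (∏ i, (b i - a i)) * (starDiscrepancy fun k => rescale a b (x k)) *
          (hardyKrauseVariation f a b).toReal := by
  set P := ∏ i, (b i - a i) with hP
  set B := P * starDiscrepancy fun k => rescale a b (x k) with hB
  set K : (u : Finset (Fin d)) → Finset (u → ℕ) := fun u =>
    Fintype.piFinset fun i : u => Finset.range (G.size i) with hK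
  set Δ : (u : Finset (Fin d)) → (u → ℕ) → ℝ := fun u k =>
    boxDifference (restrictToFace f b u) (fun i : u => G.pt i (k i))
      (fun i : u => G.pt i (k i + 1)) with hΔ
  set χ : (u : Finset (Fin d)) → (u → ℕ) → (Fin d → ℝ) → ℝ := fun u k =>
    {y : Fin d → ℝ | ∀ i : u, y i < G.pt i (k i + 1)}.indicator 1 with hχ
  set E : (u : Finset (Fin d)) → (u → ℕ) → ℝ := fun u k =>
    (∫ y in Set.Icc a b, χ u k y) - P / n * ∑ j, χ u k (x j) with hE
  have hexp : ∀ y, f (G.floor y) = ∑ u : Finset (Fin d), (-1) ^ u.card *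
      ∑ k ∈ K u, Δ u k * χ u k y := G.apply_floor_eq f
  have hχint : ∀ u k, IntegrableOn (χ u k) (Set.Icc a b) := fun u k =>
    integrableOn_indicator_corner a b _
  have hintegral : ∫ y in Set.Icc a b, f (G.floor y) = ∑ u : Finset (Fin d), (-1) ^ u.card *
      ∑ k ∈ K u, Δ u k * ∫ y in Set.Icc a b, χ u k y := by
    simp_rw [hexp]
    rw [integral_finsetSum _ fun u _ => Integrable.const_mul
      (integrable_finsetSum _ fun k _ => (hχint u k).const_mul _) _]
    refine Finset.sum_congr rfl fun u _ => ?_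
    rw [integral_const_mul, integral_finsetSum _ fun k _ => (hχint u k).const_mul _]
    simp_rw [integral_const_mul]
  have hsum : ∑ j, f (x j) = ∑ u : Finset (Fin d), (-1) ^ u.card *
      ∑ k ∈ K u, Δ u k * ∑ j, χ u k (x j) := by
    have : ∀ j, f (x j) = ∑ u : Finset (Fin d), (-1) ^ u.card *
        ∑ k ∈ K u, Δ u k * χ u k (x j) := fun j => by rw [← hexp, hG]
    simp_rw [this]
    rw [Finset.sum_comm]
    refine Finset.sum_congr rfl fun u _ => ?_
    rw [← Finset.mul_sum, Finset.sum_comm]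
    simp_rw [Finset.mul_sum]
  have herr : (∫ y in Set.Icc a b, f (G.floor y)) - P / n * ∑ k, f (x k)
      = ∑ u : Finset (Fin d), (-1) ^ u.card * ∑ k ∈ K u, Δ u k * E u k := by
    rw [hintegral, hsum, Finset.mul_sum, ← Finset.sum_sub_distrib]
    refine Finset.sum_congr rfl fun u _ => ?_
    rw [mul_left_comm, ← mul_sub, Finset.mul_sum, ← Finset.sum_sub_distrib]
    congr 1
    exact Finset.sum_congr rfl fun k _ => by simp only [hE]; ring
  have hempty : ∀ k, E ∅ k = 0 := by
    intro k
    have hχ1 : χ ∅ k = fun _ => 1 := by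
      funext y
      simp [hχ]
    have hvol : volume.real (Set.Icc a b) = P := by
      rw [Measure.real, Real.volume_Icc_pi_toReal fun i => (hab i).le]
    have hn' : (n : ℝ) ≠ 0 := Nat.cast_ne_zero.2 hn.ne'
    simp [hE, hχ1, hvol, div_mul_cancel₀ _ hn']
  have hcorner : ∀ u : Finset (Fin d), u.Nonempty → ∀ k ∈ K u, |E u k| ≤ B := by
    intro u hu k hk
    refine abs_error_corner_le a b hab x hx hxb hu _ fun i => G.pt_mem_Icc ?_
    exact Finset.mem_range.1 (Fintype.mem_piFinset.1 hk i)
  have hvit : ∀ u ∈ Finset.univ.filter fun u : Finset (Fin d) => u.Nonempty,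
      vitaliVariation (restrictToFace f b u) (fun i : u => a i) (fun i : u => b i) ≠ ∞ :=
    fun u hu => (ENNReal.sum_ne_top.1 hV) u hu
  have hΔsum : ∀ u ∈ Finset.univ.filter fun u : Finset (Fin d) => u.Nonempty,
      ∑ k ∈ K u, |Δ u k|
        ≤ (vitaliVariation (restrictToFace f b u) (fun i : u => a i) (fun i : u => b i)).toReal := by
    intro u hu
    rw [← ENNReal.ofReal_le_iff_le_toReal (hvit u hu),
      ENNReal.ofReal_sum_of_nonneg fun _ _ => abs_nonneg _]
    exact (G.face u).sum_ofReal_abs_boxDifference_le (restrictToFace f b u)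
  rw [herr, ← Finset.sum_filter_of_ne (p := fun u : Finset (Fin d) => u.Nonempty)]
  · rw [hardyKrauseVariation, ENNReal.toReal_sum hvit, Finset.mul_sum]
    refine (Finset.abs_sum_le_sum_abs _ _).trans (Finset.sum_le_sum fun u hu => ?_)
    have hu' : u.Nonempty := (Finset.mem_filter.1 hu).2
    have hB0 : 0 ≤ B := by
      have hdisc : 0 ≤ starDiscrepancy fun k => rescale a b (x k) :=
        Real.iSup_nonneg fun _ => abs_nonneg _
      exact mul_nonneg (Finset.prod_nonneg fun i _ => (sub_pos.2 (hab i)).le) hdisc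
    calc |(-1) ^ u.card * ∑ k ∈ K u, Δ u k * E u k|
        = |∑ k ∈ K u, Δ u k * E u k| := by simp [abs_mul]
      _ ≤ ∑ k ∈ K u, |Δ u k| * B := by
          refine (Finset.abs_sum_le_sum_abs _ _).trans (Finset.sum_le_sum fun k hk => ?_)
          rw [abs_mul]
          exact mul_le_mul_of_nonneg_left (hcorner u hu' k hk) (abs_nonneg _)
      _ = B * ∑ k ∈ K u, |Δ u k| := by rw [← Finset.sum_mul, mul_comm]
      _ ≤ _ := mul_le_mul_of_nonneg_left (hΔsum u hu) hB0
  · intro u _ hu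
    rw [Finset.nonempty_iff_ne_empty]
    rintro rfl
    simp [hempty] at hu

end Grid

/-! ### Passage to the limit -/

/-- Grids through the given points along which rounding down converges to the identity: they
contain more and more points of a dense sequence. -/
theorem exists_boxGrid_tendsto_floor {ι : Type*} {n : ℕ} {a b : ι → ℝ} (hab : a ≤ b)
    (x : Fin n → ι → ℝ) (hx : ∀ k, x k ∈ Set.Icc a b) :
    ∃ G : ℕ → BoxGrid a b, (∀ N k, (G N).floor (x k) = x k) ∧
      ∀ y ∈ Set.Icc a b, Filter.Tendsto (fun N => (G N).floor y) Filter.atTop (nhds y) := by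
  classical
  set s : ι → ℕ → ℝ := fun i j => max (a i) (min (b i) (TopologicalSpace.denseSeq ℝ j)) with hs
  have hs_mem : ∀ i j, s i j ∈ Set.Icc (a i) (b i) := fun i j =>
    ⟨le_max_left _ _, max_le (hab i) (min_le_left _ _)⟩
  have hG : ∀ N : ℕ, ∃ G : BoxGrid a b, ∀ i, ∀ t ∈ (Finset.univ.image fun k => x k i) ∪
      (Finset.range N).image (s i), ∃ k ≤ G.size i, G.pt i k = t := by
    refine fun N => BoxGrid.exists_pt_eq hab _ fun i t ht => ?_
    rcases Finset.mem_union.1 ht with ht | ht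
    · obtain ⟨k, _, rfl⟩ := Finset.mem_image.1 ht
      exact ⟨(hx k).1 i, (hx k).2 i⟩
    · obtain ⟨j, _, rfl⟩ := Finset.mem_image.1 ht
      exact hs_mem i j
  choose G hG using hG
  refine ⟨G, fun N k => (G N).floor_eq_self fun i => hG N i _ ?_, fun y hy => ?_⟩
  · exact Finset.mem_union_left _ (Finset.mem_image_of_mem _ (Finset.mem_univ k))
  refine tendsto_pi_nhds.2 fun i => tendsto_order.2 ⟨fun r hr => ?_, fun r hr => ?_⟩
  · rcases (hy.1 i).eq_or_lt with hay | hay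
    · exact Filter.Eventually.of_forall fun N =>
        (hr.trans_eq hay.symm).trans_le ((G N).le_floor y i)
    · obtain ⟨t, ⟨j, rfl⟩, hrt, hty⟩ :=
        (TopologicalSpace.denseRange_denseSeq ℝ).exists_between (max_lt hr hay)
      have hsj : s i j = TopologicalSpace.denseSeq ℝ j := by
        rw [hs]
        beta_reduce
        rw [min_eq_right (hty.le.trans (hy.2 i)), max_eq_right ((le_max_right _ _).trans hrt.le)]
      filter_upwards [Filter.eventually_gt_atTop j] with N hN
      obtain ⟨k, hk, hpt⟩ := hG N i (s i j)
        (Finset.mem_union_right _ (Finset.mem_image_of_mem _ (Finset.mem_range.2 hN)))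
      rw [hsj] at hpt
      calc r < TopologicalSpace.denseSeq ℝ j := (le_max_left _ _).trans_lt hrt
        _ = (G N).pt i k := hpt.symm
        _ ≤ (G N).floor y i := (G N).pt_le_floor hk (hpt.trans_le hty.le)
  · exact Filter.Eventually.of_forall fun N => ((G N).floor_le hy.1 i).trans_lt hr

/-- Approach from below suffices for convergence of the values of `f` wherever the variation is
continuous as a function of the lower corner. -/
theorem tendsto_of_continuousAt_hardyKrauseVariation {ι : Type*} [Fintype ι] [DecidableEq ι]
    {f : (ι → ℝ) → ℝ} {b y : ι → ℝ} {z : ℕ → ι → ℝ} (hz : ∀ N, z N ≤ y) (hyb : y ≤ b)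
    (hzy : Filter.Tendsto z Filter.atTop (nhds y)) (hV : hardyKrauseVariation f y b ≠ ∞)
    (hc : ContinuousAt (fun y => hardyKrauseVariation f y b) y) :
    Filter.Tendsto (fun N => f (z N)) Filter.atTop (nhds (f y)) := by
  have hlim : Filter.Tendsto
      (fun N => hardyKrauseVariation f (z N) b - hardyKrauseVariation f y b)
      Filter.atTop (nhds 0) := by
    have h := ENNReal.Tendsto.sub (hc.tendsto.comp hzy)
      (tendsto_const_nhds (x := hardyKrauseVariation f y b)) (Or.inl hV)
    rwa [tsub_self] at h
  rw [tendsto_iff_edist_tendsto_0]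
  refine tendsto_of_tendsto_of_tendsto_of_le_of_le tendsto_const_nhds hlim
    (fun _ => zero_le) fun N => ?_
  rw [edist_dist, Real.dist_eq]
  exact ENNReal.le_sub_of_add_le_right hV
    (ofReal_abs_sub_add_hardyKrauseVariation_le f (hz N) hyb)

theorem theorem2 {d n : ℕ} (hn : 0 < n) (a b : Fin d → ℝ) (hab : ∀ i, a i < b i)
    (f : (Fin d → ℝ) → ℝ) (x : Fin n → Fin d → ℝ) (hx : ∀ k, x k ∈ Set.Icc a b)
    (hxb : 2 ≤ d → ∀ k i, x k i < b i) :
    (hardyKrauseVariation f a b ≠ ∞ → IntegrableOn f (Set.Icc a b)) ∧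
    ENNReal.ofReal |(∫ y in Set.Icc a b, f y) - (∏ i, (b i - a i)) / n * ∑ k, f (x k)|
      ≤ ENNReal.ofReal (∏ i, (b i - a i)) *
          ENNReal.ofReal (starDiscrepancy fun k => rescale a b (x k)) *
          hardyKrauseVariation f a b := by
  have hP : 0 < ∏ i, (b i - a i) := Finset.prod_pos fun i _ => sub_pos.2 (hab i)
  by_cases hV : hardyKrauseVariation f a b = ∞
  · refine ⟨fun h => absurd hV h, ?_⟩
    -- In dimension `0` there is no nonempty face and the variation is `0`.
    have hd : 0 < d := by
      rcases Nat.eq_zero_or_pos d with rfl | hd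
      · have hnone : ∀ u : Finset (Fin 0), ¬ u.Nonempty := fun u ⟨i, _⟩ => i.elim0
        simp [hardyKrauseVariation, hnone] at hV
      · exact hd
    rw [hV, ENNReal.mul_top]
    · exact le_top
    · exact mul_ne_zero (ENNReal.ofReal_pos.2 hP).ne'
        (ENNReal.ofReal_pos.2 (starDiscrepancy_pos hd hn _)).ne'
  have hab' : a ≤ b := fun i => (hab i).le
  obtain ⟨G, hGx, hGlim⟩ := exists_boxGrid_tendsto_floor hab' x hx
  have hVy : ∀ y, a ≤ y → hardyKrauseVariation f y b ≠ ∞ := fun y hy =>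
    ne_top_of_le_ne_top hV (hardyKrauseVariation_antitone f b hy)
  have hlim : ∀ᵐ y ∂volume.restrict (Set.Icc a b),
      Filter.Tendsto (fun N => f ((G N).floor y)) Filter.atTop (nhds (f y)) := by
    filter_upwards [ae_restrict_mem measurableSet_Icc,
      ae_restrict_of_ae (hardyKrauseVariation_antitone f b).ae_continuousAt_pi] with y hy hc
    exact tendsto_of_continuousAt_hardyKrauseVariation (fun N => (G N).floor_le hy.1) hy.2
      (hGlim y hy) (hVy y hy.1) hc
  have hbound : ∀ y ∈ Set.Icc a b, ‖f y‖ ≤ |f b| + (hardyKrauseVariation f a b).toReal := by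
    intro y hy
    have h1 : ENNReal.ofReal |f y - f b| ≤ hardyKrauseVariation f a b :=
      (le_self_add.trans (ofReal_abs_sub_add_hardyKrauseVariation_le f hy.2 le_rfl)).trans
        (hardyKrauseVariation_antitone f b hy.1)
    have h2 : |f y - f b| ≤ (hardyKrauseVariation f a b).toReal :=
      (ENNReal.ofReal_le_iff_le_toReal hV).1 h1
    rw [Real.norm_eq_abs]
    linarith [abs_sub_abs_le_abs_sub (f y) (f b)]
  have hmeas : AEStronglyMeasurable f (volume.restrict (Set.Icc a b)) :=
    aestronglyMeasurable_of_tendsto_ae Filter.atTop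
      (fun N => ((G N).integrableOn_comp_floor f).aestronglyMeasurable) hlim
  have hconst : IntegrableOn (fun _ : Fin d → ℝ => |f b| + (hardyKrauseVariation f a b).toReal)
      (Set.Icc a b) := integrableOn_const isCompact_Icc.measure_lt_top.ne
  refine ⟨fun _ => hconst.mono' hmeas
    ((ae_restrict_mem measurableSet_Icc).mono fun y hy => hbound y hy), ?_⟩
  have hint : Filter.Tendsto (fun N => ∫ y in Set.Icc a b, f ((G N).floor y)) Filter.atTop
      (nhds (∫ y in Set.Icc a b, f y)) :=
    tendsto_integral_of_dominated_convergence _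
      (fun N => ((G N).integrableOn_comp_floor f).aestronglyMeasurable) hconst
      (fun N => (ae_restrict_mem measurableSet_Icc).mono fun y hy =>
        hbound _ ⟨(G N).le_floor y, ((G N).floor_le hy.1).trans hy.2⟩) hlim
  have hle := le_of_tendsto (hint.sub_const _).abs (Filter.Eventually.of_forall fun N =>
    (G N).abs_integral_comp_floor_sub_le hn hab f x hx hxb hV (hGx N))
  have hdisc : 0 ≤ starDiscrepancy fun k => rescale a b (x k) :=
    Real.iSup_nonneg fun _ => abs_nonneg _
  rw [← ENNReal.ofReal_toReal hV, ← ENNReal.ofReal_mul hP.le,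
    ← ENNReal.ofReal_mul (mul_nonneg hP.le hdisc)]
  exact ENNReal.ofReal_le_ofReal hle
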